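/- Let $R$ be a commutative noetherian ring and let $\operatorname{mod} R$ be the category of finitely generated $R$-modules. A (strictly full) subcategory $\mathcal{X}$ of $\operatorname{mod} R$ is called IKE-closed if it is closed under images and kernels (the image and the kernel of every homomorphism $X\to X'$ with $X,X'\in\mathcal{X}$ belong to $\mathcal{X}$) and under extensions (if $0\to L\to M\to N\to 0$ is exact in $\operatorname{mod} R$ and $L,N\in\mathcal{X}$, then $M\in\mathcal{X}$). It is called torsionfree if it is closed under submodules and extensions. Put $\operatorname{Ass}\mathcal{X}=\bigcup_{X\in\mathcal{X}}\operatorname{Ass}_R X\subseteq\operatorname{Spec} R$, and for $\Phi\subseteq\operatorname{Spec} R$ let $\operatorname{Ass}^{-1}\Phi$ be the subcategory of all $M\in\operatorname{mod} R$ with $\operatorname{Ass}_R M\subseteq\Phi$. Let $(R,\mathfrak{m},k)$ be a $2$-dimensional excellent normal local domain of characteristic $0$, and let $\mathcal{X}$ be an IKE-closed subcategory of $\operatorname{mod} R$ with $\mathfrak{m}\in\operatorname{Ass}\mathcal{X}$. Then $\mathcal{X}=\operatorname{Ass}^{-1}(\operatorname{Ass}\mathcal{X})$, and $\mathcal{X}$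 is torsionfree. -/

import Mathlib

universe u

section ExcellentRings

open TensorProduct

/-- A ring is catenary if for all primes `p ⊆ q` the lengths of the chains of primes from `p` to `q`
are bounded and all saturated chains (each step is a covering) from `p` to `q` have the same
length. -/
structure IsCatenaryRing (A : Type u) [CommRing A] : Prop where
  bounded : ∀ p q : PrimeSpectrum A, ∃ n : ℕ, ∀ s : LTSeries (PrimeSpectrum A),
    s.head = p → s.last = q → s.length ≤ n
  length_eq : ∀ s t : RelSeries {(p, q) : PrimeSpectrum A × PrimeSpectrum A | p ⋖ q},
    s.head = t.head → s.last = t.last → s.length = t.length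

/-- `R` is universally catenary if every finitely generated `R`-algebra is catenary. -/
def IsUniversallyCatenaryRing (R : Type u) [CommRing R] : Prop :=
  ∀ (A : Type u) [CommRing A] [Algebra R A], Algebra.FiniteType R A → IsCatenaryRing A

/-- The regular locus of `A`: the primes `p` for which `A_p` is a regular local ring. -/
def regularLocus (A : Type u) [CommRing A] : Set (PrimeSpectrum A) :=
  {p | IsRegularLocalRing (Localization.AtPrime p.asIdeal)}

/-- `R` is J-2 if every finitely generated `R`-algebra has open regular locus. -/
def IsJTwoRing (R : Type u) [CommRing R] : Prop :=
  ∀ (A : Type u) [CommRing A] [Algebra R A], Algebra.FiniteType R A → IsOpen (regularLocus A)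

/-- A (noetherian) algebra `A` over a field `k` is geometrically regular if `L ⊗ A` is a regular
ring for every finite field extension `L` of `k`. -/
def IsGeometricallyRegularAlgebra (k A : Type u) [Field k] [CommRing A] [Algebra k A] : Prop :=
  ∀ (L : Type u) [Field L] [Algebra k L], FiniteDimensional k L → IsRegularRing (L ⊗[k] A)

/-- The formal fibres of a local ring `R`, i.e. the fibres `κ(q) ⊗ R^` of the map from `R` to its
completion with respect to the maximal ideal, are geometrically regular. -/
def HasGeometricallyRegularFormalFibers (R : Type u) [CommRing R] [IsLocalRing R] : Prop :=
  ∀ (q : Ideal R) [q.IsPrime], IsGeometricallyRegularAlgebra q.ResidueField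
    (q.Fiber (AdicCompletion (IsLocalRing.maximalIdeal R) R))

/-- `R` is a G-ring if the formal fibres of all its localizations at primes are geometrically
regular. -/
def IsGrothendieckRing (R : Type u) [CommRing R] : Prop :=
  ∀ (p : Ideal R) [p.IsPrime], HasGeometricallyRegularFormalFibers (Localization.AtPrime p)

/-- An excellent ring is a noetherian, universally catenary G-ring which is J-2. -/
structure IsExcellentRing (R : Type u) [CommRing R] : Prop where
  isNoetherianRing : IsNoetherianRing R
  universallyCatenary : IsUniversallyCatenaryRing R
  grothendieck : IsGrothendieckRing R
  jTwo : IsJTwoRing R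

end ExcellentRings

namespace FGModuleCat

open CategoryTheory

variable {R : Type u} [CommRing R]

/-- `X` is closed under images: the image of each homomorphism between modules in `X` is
in `X`. -/
def IsClosedUnderImages (X : ObjectProperty (FGModuleCat.{u} R)) : Prop :=
  ∀ ⦃M N : FGModuleCat.{u} R⦄ (f : M ⟶ N), X M → X N →
    X (FGModuleCat.of R (LinearMap.range f.hom.hom))

/-- `X` is IKE-closed: closed under images, kernels and extensions. -/
structure IsIKEClosed (X : ObjectProperty (FGModuleCat.{u} R)) : Prop where
  images : IsClosedUnderImages X
  kernels : X.IsClosedUnderKernels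
  extensions : X.IsClosedUnderExtensions

/-- `X` is torsionfree: closed under subobjects and extensions. -/
structure IsTorsionfreeSubcategory (X : ObjectProperty (FGModuleCat.{u} R)) : Prop where
  subobjects : X.IsClosedUnderSubobjects
  extensions : X.IsClosedUnderExtensions

/-- `Ass X`, the union of the sets of associated primes of the modules in `X`. -/
def Ass (X : ObjectProperty (FGModuleCat.{u} R)) : Set (PrimeSpectrum R) :=
  {p | ∃ M : FGModuleCat.{u} R, X M ∧ p.asIdeal ∈ associatedPrimes R M}

/-- `Ass⁻¹ Φ`, the finitely generated modules all of whose associated primes lie in `Φ`. -/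
def AssInv (Φ : Set (PrimeSpectrum R)) : ObjectProperty (FGModuleCat.{u} R) :=
  fun M ↦ ∀ p : PrimeSpectrum R, p.asIdeal ∈ associatedPrimes R M → p ∈ Φ

end FGModuleCat

/-! A module M is filtered by submodules of the `R ⧸ p`, p ∈ Ass M
(`IsIKEClosed.prop_of_associatedPrimes`), so it suffices that p ∈ Ass X puts every submodule of `R ⧸
p` in X. Some nonzero submodule is in X (`IsIKEClosed.exists_submodule_quotient`). If p = m, then `R
⧸ p` is simple, and X contains all modules of finite length. If p has height one, proper quotients
of `R ⧸ p` have finite length, so one nonzero submodule yields all.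

If p = 0, let I ≠ 0 be an ideal in X and D ⊆ I a copy of the wanted ideal
(`IsIKEClosed.ideal_of_ideal`). By normality, ideals are principal near finitely many height one
primes, so I has a copy B ⊆ D that agrees with D at the nonmaximal primes where D and I differ.
Gluing I near these primes with B elsewhere gives E ⊆ I such that, on the punctured spectrum, D ∩ E
= B and D + E = I. Hence D ∩ E and D + E are in X, so is their extension D ⊕ E, and D is the image
of a projector.

Torsionfreeness follows, since Ass shrinks on submodules. -/

namespace FGModuleCat

open CategoryTheory

/-! ### Closure properties in terms of modules and linear maps -/

section ModuleClosure

variable {R : Type u} [CommRing R] {X : ObjectProperty (FGModuleCat.{u} R)}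
  {L M N : Type u} [AddCommGroup L] [Module R L] [Module.Finite R L]
  [AddCommGroup M] [Module R M] [Module.Finite R M] [AddCommGroup N] [Module R N]
  [Module.Finite R N]

theorem prop_of_equiv [X.IsClosedUnderIsomorphisms] (e : M ≃ₗ[R] N) (h : X (of R M)) :
    X (of R N) :=
  X.prop_of_iso e.toFGModuleCatIso h

theorem IsIKEClosed.range (hX : IsIKEClosed X) (f : M →ₗ[R] N) (hM : X (of R M))
    (hN : X (of R N)) : X (of R (LinearMap.range f)) :=
  hX.images (ofHom f) hM hN

theorem IsIKEClosed.subsingleton [X.IsClosedUnderIsomorphisms] (hX : IsIKEClosed X)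
    (hM : X (of R M)) [Subsingleton N] : X (of R N) :=
  prop_of_equiv ((LinearEquiv.ofEq _ _ LinearMap.range_zero).trans
    ((0 : (⊥ : Submodule R M) ≃ₗ[R] N))) (hX.range (0 : M →ₗ[R] M) hM hM)

theorem IsIKEClosed.range_of_comp [X.IsClosedUnderIsomorphisms]
    {L : Type u} [AddCommGroup L] [Module R L] (hX : IsIKEClosed X)
    (g : M →ₗ[R] L) {i : L →ₗ[R] N} (hi : Function.Injective i) (hM : X (of R M))
    (hN : X (of R N)) : X (of R (LinearMap.range g)) := by
  refine prop_of_equiv ?_ (hX.range (i ∘ₗ g) hM hN)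
  exact (LinearEquiv.ofEq _ _ (LinearMap.range_comp g i)).trans
    (Submodule.equivMapOfInjective i hi _).symm

variable [IsNoetherianRing R]

theorem IsIKEClosed.ker (hX : IsIKEClosed X) (f : M →ₗ[R] N) (hM : X (of R M))
    (hN : X (of R N)) : X (of R (LinearMap.ker f)) := by
  have := hX.kernels
  let i : of R (LinearMap.ker f) ⟶ of R M := ofHom (LinearMap.ker f).subtype
  have w : i ≫ ofHom f = 0 := by
    ext x
    exact x.2
  have hi : Mono i := ConcreteCategory.mono_of_injective _ Subtype.val_injective
  refine X.prop_of_isLimit_kernelFork (f := ofHom f) (k := Limits.KernelFork.ofι i w) ?_ hM hN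
  refine @Limits.KernelFork.IsLimit.ofι' _ _ _ _ _ _ _ i w (fun {A} k hk => ?_) hi
  refine ⟨InducedCategory.homMk (ModuleCat.ofHom
    (LinearMap.codRestrict (LinearMap.ker f) k.hom.hom fun c => ?_)), ?_⟩
  · have := congrArg (fun g => g.hom.hom c) hk
    exact this
  · ext x
    rfl

theorem IsIKEClosed.extension (hX : IsIKEClosed X) {f : L →ₗ[R] M} {g : M →ₗ[R] N}
    (hf : Function.Injective f) (hg : Function.Surjective g) (hfg : Function.Exact f g)
    (hL : X (of R L)) (hN : X (of R N)) : X (of R M) := by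
  have := hX.extensions
  let S : ShortComplex (FGModuleCat R) := ShortComplex.mk (ofHom f) (ofHom g) (by
    ext x
    exact hfg.apply_apply_eq_zero x)
  have hS : S.ShortExact :=
    { exact := by
        refine (forget₂ (FGModuleCat R) (ModuleCat R)).reflects_exact_of_faithful _ ?_
        rw [ShortComplex.ShortExact.moduleCat_exact_iff_function_exact]
        exact hfg
      mono_f := ConcreteCategory.mono_of_injective _ hf
      epi_g := ConcreteCategory.epi_of_surjective _ hg }
  exact X.prop_X₂_of_shortExact hS hL hN

theorem IsIKEClosed.of_submodule (hX : IsIKEClosed X) (K : Submodule R M) (hK : X (of R K))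
    (hQ : X (of R (M ⧸ K))) : X (of R M) :=
  hX.extension K.injective_subtype K.mkQ_surjective (LinearMap.exact_subtype_mkQ K) hK hQ

theorem IsIKEClosed.submodule [X.IsClosedUnderIsomorphisms] (hX : IsIKEClosed X)
    (K : Submodule R M) (hM : X (of R M)) (hQ : X (of R (M ⧸ K))) : X (of R K) :=
  prop_of_equiv (LinearEquiv.ofEq _ _ K.ker_mkQ) (hX.ker K.mkQ hM hQ)

end ModuleClosure

end FGModuleCat

/-! ### Associated primes and submodules of `R ⧸ p` -/

section

variable {R : Type*} [CommRing R] {p : Ideal R}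

open scoped Classical in
-- A common denominator `a` for finitely many generators turns multiplication by `a` into a map to
-- `R ⧸ p`.
theorem exists_linearMap_of_forall_smul_mem_range {Y : Type*} [AddCommGroup Y] [Module R Y]
    [Module.Finite R Y] [hp : p.IsPrime] {i : R ⧸ p →ₗ[R] Y} (hi : Function.Injective i)
    (h : ∀ y, ∃ a ∉ p, a • y ∈ LinearMap.range i) :
    ∃ a ∉ p, ∃ φ : Y →ₗ[R] R ⧸ p, ∀ y, i (φ y) = a • y := by
  obtain ⟨s, hs⟩ := Module.Finite.fg_top (R := R) (M := Y)
  choose a ha hay using h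
  have hle : ∀ y, (∏ x ∈ s, a x) • y ∈ LinearMap.range i := by
    intro y
    have hy : y ∈ Submodule.span R (s : Set Y) := hs ▸ Submodule.mem_top
    induction hy using Submodule.span_induction with
    | mem x hx =>
      rw [← Finset.prod_erase_mul s a hx, mul_smul]
      exact Submodule.smul_mem _ _ (hay x)
    | zero => simp
    | add x y _ _ hx hy => rw [smul_add]; exact add_mem hx hy
    | smul r x _ hx => rw [smul_comm]; exact Submodule.smul_mem _ _ hx
  refine ⟨∏ x ∈ s, a x, fun hmem => ?_, (LinearEquiv.ofInjective i hi).symm.toLinearMap ∘ₗ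
    LinearMap.codRestrict (LinearMap.range i) ((∏ x ∈ s, a x) • LinearMap.id) hle, fun y => ?_⟩
  · obtain ⟨x, -, hx⟩ := hp.prod_mem_iff.1 hmem
    exact ha x hx
  · have := (LinearEquiv.ofInjective i hi).apply_symm_apply (LinearMap.codRestrict
      (LinearMap.range i) ((∏ x ∈ s, a x) • LinearMap.id) hle y)
    exact congrArg Subtype.val this

theorem smul_eq_zero_iff_mem_of_injective {Y : Type*} [AddCommGroup Y] [Module R Y]
    {i : R ⧸ p →ₗ[R] Y} (hi : Function.Injective i) (r : R) :
    r • i 1 = 0 ↔ r ∈ p := by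
  rw [← map_smul, map_eq_zero_iff i hi, ← Ideal.Quotient.eq_zero_iff_mem,
    Algebra.smul_def, mul_one]
  rfl

theorem isAssociatedPrime_iff_exists_smul_eq_zero_iff [IsNoetherianRing R] {M : Type*}
    [AddCommGroup M] [Module R M] :
    IsAssociatedPrime p M ↔ p.IsPrime ∧ ∃ x : M, ∀ r, r • x = 0 ↔ r ∈ p := by
  rw [isAssociatedPrime_iff]
  refine and_congr_right fun _ => exists_congr fun x => ?_
  rw [SetLike.ext_iff]
  refine forall_congr' fun r => ?_
  rw [Submodule.mem_colon_singleton, Submodule.mem_bot]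
  exact Iff.comm

/-- A maximal associated prime `p` of `M` splits off a submodule isomorphic to an ideal of `R ⧸ p`
without creating new associated primes in the quotient. -/
theorem exists_submodule_of_associatedPrimes [IsNoetherianRing R] (M : Type*)
    [AddCommGroup M] [Module R M] [Module.Finite R M] [Nontrivial M] :
    ∃ p ∈ associatedPrimes R M, ∃ (N : Submodule R M) (J : Submodule R (R ⧸ p)),
      N ≠ ⊥ ∧ Nonempty (N ≃ₗ[R] J) ∧ associatedPrimes R (M ⧸ N) ⊆ associatedPrimes R M := by
  obtain ⟨(p : Ideal R), hpM, hmax⟩ := set_has_maximal_iff_noetherian.mpr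
    (inferInstance : IsNoetherian R R) (associatedPrimes R M : Set (Ideal R))
    (associatedPrimes.nonempty R M)
  have hp : p.IsPrime := hpM.1
  obtain ⟨-, i, hi⟩ := (isAssociatedPrime_iff_exists_injective_linearMap p M).1 hpM
  -- The elements killed by p that are torsion modulo the copy of `R ⧸ p`.
  let N : Submodule R M :=
    { carrier := {y | (∀ b ∈ p, b • y = 0) ∧ ∃ a ∉ p, a • y ∈ LinearMap.range i}
      add_mem' := by
        rintro y z ⟨hy, a, ha, hay⟩ ⟨hz, b, hb, hbz⟩
        refine ⟨fun c hc => by rw [smul_add, hy c hc, hz c hc, add_zero], a * b,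
          fun h => (hp.mem_or_mem h).elim ha hb, ?_⟩
        rw [smul_add]
        refine add_mem ?_ ?_
        · rw [mul_comm, mul_smul]
          exact Submodule.smul_mem _ _ hay
        · rw [mul_smul]
          exact Submodule.smul_mem _ _ hbz
      zero_mem' := ⟨by simp, 1, fun h => hp.ne_top ((Ideal.eq_top_iff_one p).2 h), by simp⟩
      smul_mem' := by
        rintro c y ⟨hy, a, ha, hay⟩
        refine ⟨fun b hb => by rw [smul_comm, hy b hb, smul_zero], a, ha, ?_⟩
        rw [smul_comm]
        exact Submodule.smul_mem _ _ hay }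
  have hiN : ∀ z, i z ∈ N := fun z => by
    refine ⟨fun b hb => ?_, 1, fun h => hp.ne_top ((Ideal.eq_top_iff_one p).2 h), by simp⟩
    obtain ⟨r, rfl⟩ := Ideal.Quotient.mk_surjective z
    have : b • (Ideal.Quotient.mk p r) = 0 :=
      Ideal.Quotient.eq_zero_iff_mem.2 (p.mul_mem_right r hb)
    rw [← map_smul, this, map_zero]
  -- A nonzero element killed by p and by some a ∉ p would give an associated prime strictly above
  -- p.
  have htf : ∀ a ∉ p, ∀ y ∈ N, a • y = 0 → y = 0 := by
    rintro a ha y ⟨hy, b, hb, z, hz⟩ hay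
    obtain ⟨r, rfl⟩ := Ideal.Quotient.mk_surjective z
    have h1 : a • i (Ideal.Quotient.mk p r) = 0 := by rw [hz, smul_comm, hay, smul_zero]
    rw [← map_smul, map_eq_zero_iff i hi] at h1
    have h2 : r ∈ p := (hp.mem_or_mem (Ideal.Quotient.eq_zero_iff_mem.1 h1)).resolve_left ha
    rw [Ideal.Quotient.eq_zero_iff_mem.2 h2, map_zero] at hz
    by_contra hy0
    obtain ⟨Q, hQ, hle⟩ := exists_le_isAssociatedPrime_of_isNoetherianRing R y hy0
    have hpQ : p < Q := by
      refine lt_of_le_of_ne (fun c hc => hle ?_) ?_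
      · rw [Submodule.mem_colon_singleton, Submodule.mem_bot]
        exact hy c hc
      · rintro rfl
        refine ha (hle ?_)
        rwa [Submodule.mem_colon_singleton, Submodule.mem_bot]
    exact hmax Q hQ hpQ
  let i' : R ⧸ p →ₗ[R] N := LinearMap.codRestrict N i hiN
  have hi' : Function.Injective i' := fun x y h => hi (congrArg Subtype.val h)
  obtain ⟨a, ha, φ, hφ⟩ := exists_linearMap_of_forall_smul_mem_range hi' (fun y => by
    obtain ⟨-, b, hb, z, hz⟩ := y.2
    exact ⟨b, hb, z, Subtype.ext hz⟩)
  have hφi : Function.Injective φ := by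
    rw [injective_iff_map_eq_zero]
    intro y hy
    have := hφ y
    rw [hy, map_zero] at this
    exact Subtype.ext (htf a ha y y.2 (congrArg Subtype.val this.symm))
  refine ⟨p, hpM, N, LinearMap.range φ, fun h => ?_, ⟨LinearEquiv.ofInjective φ hφi⟩, ?_⟩
  · have h1 : i 1 = 0 := by simpa [h] using hiN 1
    refine hp.ne_top ((Ideal.eq_top_iff_one p).2 ?_)
    rw [← smul_eq_zero_iff_mem_of_injective hi, h1, smul_zero]
  · intro q hq
    obtain ⟨hqp, y, hy⟩ := isAssociatedPrime_iff_exists_smul_eq_zero_iff.1 hq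
    obtain ⟨y, rfl⟩ := N.mkQ_surjective y
    replace hy : ∀ r, r • y ∈ N ↔ r ∈ q := fun r => by
      rw [← hy, ← map_smul, Submodule.mkQ_apply, Submodule.Quotient.mk_eq_zero]
    by_cases hpq : p ≤ q
    · suffices q ≤ p from le_antisymm this hpq ▸ hpM
      by_cases hpy : ∀ b ∈ p, b • y = 0
      · intro c hc
        by_contra hcp
        obtain ⟨-, b, hb, hbc⟩ := (hy c).2 hc
        refine hqp.ne_top ((Ideal.eq_top_iff_one q).2 ((hy 1).1 ?_))
        rw [one_smul]
        refine ⟨hpy, b * c, fun h => (hp.mem_or_mem h).elim hb hcp, ?_⟩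
        rwa [mul_smul]
      · push Not at hpy
        obtain ⟨b, hb, hby⟩ := hpy
        obtain ⟨Q, hQ, hle⟩ := exists_le_isAssociatedPrime_of_isNoetherianRing R _ hby
        have hqQ : q ≤ Q := fun c hc => hle (by
          rw [Submodule.mem_colon_singleton, Submodule.mem_bot, smul_comm]
          exact ((hy c).2 hc).1 b hb)
        have := hmax Q hQ
        have hQp : p = Q := by
          by_contra hne
          exact this (lt_of_le_of_ne (hpq.trans hqQ) hne)
        exact hQp ▸ hqQ
    -- As q • y lies in N, which p kills, r • y has annihilator exactly q.
    · obtain ⟨r, hrp, hrq⟩ := SetLike.not_le_iff_exists.1 hpq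
      refine isAssociatedPrime_iff_exists_smul_eq_zero_iff.2 ⟨hqp, r • y, fun s => ⟨fun h => ?_,
        fun h => ?_⟩⟩
      · rw [smul_smul] at h
        refine (hqp.mem_or_mem ((hy (s * r)).1 ?_)).resolve_right hrq
        rw [h]
        exact N.zero_mem
      · rw [smul_comm]
        exact ((hy s).2 h).1 r hrp

end

/-! ### From Ass X to modules in X -/

namespace FGModuleCat

open CategoryTheory

variable {R : Type u} [CommRing R] [IsNoetherianRing R] {X : ObjectProperty (FGModuleCat.{u} R)}

/-- Take M with maximal annihilator: for a ∈ p, the kernel of a on M still has p associated, so its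
annihilator, which contains a, is no larger. -/
theorem IsIKEClosed.exists_le_annihilator (hX : IsIKEClosed X) {p : PrimeSpectrum R}
    (hp : p ∈ Ass X) : ∃ M : FGModuleCat.{u} R, X M ∧ p.asIdeal ∈ associatedPrimes R M ∧
      p.asIdeal ≤ Module.annihilator R M := by
  obtain ⟨M₀, hM₀, hpM₀⟩ := hp
  obtain ⟨(I : Ideal R), ⟨M, hM, hpM, rfl⟩, hmax⟩ := set_has_maximal_iff_noetherian.mpr
    (inferInstance : IsNoetherian R R) ({I | ∃ M : FGModuleCat.{u} R, X M ∧
      p.asIdeal ∈ associatedPrimes R M ∧ I = Module.annihilator R M} : Set (Ideal R))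
    ⟨_, M₀, hM₀, hpM₀, rfl⟩
  refine ⟨M, hM, hpM, fun a ha => ?_⟩
  let f : M →ₗ[R] M := a • LinearMap.id
  have hker : X (of R (LinearMap.ker f)) := hX.ker f hM hM
  have hle : Module.annihilator R M ≤ Module.annihilator R (LinearMap.ker f) :=
    LinearMap.annihilator_le_of_injective (LinearMap.ker f).subtype Subtype.val_injective
  have hass : p.asIdeal ∈ associatedPrimes R (LinearMap.ker f) := by
    obtain ⟨h, x, hx⟩ := isAssociatedPrime_iff_exists_smul_eq_zero_iff.1 hpM
    refine isAssociatedPrime_iff_exists_smul_eq_zero_iff.2 ⟨h, ⟨x, (hx a).2 ha⟩, fun r => ?_⟩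
    exact Subtype.ext_iff.trans (hx r)
  have hn := hmax _ ⟨of R (LinearMap.ker f), hker, hass, rfl⟩
  have heq : Module.annihilator R M = Module.annihilator R (LinearMap.ker f) := by
    by_contra hne
    exact hn (lt_of_le_of_ne hle hne)
  rw [heq, Module.mem_annihilator]
  exact fun m => Subtype.ext m.2

variable [X.IsClosedUnderIsomorphisms]

/-- With M killed by p and U maximal among submodules meeting the copy of `R ⧸ p` trivially, that
copy is essential in M/U. Clearing denominators gives M → M/U → `R ⧸ p`, and following it by `R ⧸ p`
→ M makes its image that of an endomorphism of M. -/
theorem IsIKEClosed.exists_submodule_quotient (hX : IsIKEClosed X) {p : PrimeSpectrum R}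
    (hp : p ∈ Ass X) : ∃ I : Submodule R (R ⧸ p.asIdeal), I ≠ ⊥ ∧ X (of R I) := by
  obtain ⟨M, hM, hpM, hle⟩ := hX.exists_le_annihilator hp
  obtain ⟨-, i, hi⟩ := (isAssociatedPrime_iff_exists_injective_linearMap p.asIdeal M).1 hpM
  have h1 : (1 : R) ∉ p.asIdeal := fun h => p.2.ne_top ((Ideal.eq_top_iff_one _).2 h)
  obtain ⟨U, hU : U ⊓ LinearMap.range i = ⊥, hmax⟩ := set_has_maximal_iff_noetherian.mpr
    (inferInstance : IsNoetherian R M) {U | U ⊓ LinearMap.range i = ⊥} ⟨⊥, bot_inf_eq _⟩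
  have hj : Function.Injective (U.mkQ ∘ₗ i) := by
    rw [injective_iff_map_eq_zero]
    intro x hx
    have hxU : i x ∈ U := by simpa using hx
    have : i x ∈ U ⊓ LinearMap.range i := ⟨hxU, x, rfl⟩
    rw [hU, Submodule.mem_bot, map_eq_zero_iff i hi] at this
    exact this
  have hess : ∀ y : M ⧸ U, ∃ a ∉ p.asIdeal, a • y ∈ LinearMap.range (U.mkQ ∘ₗ i) := by
    intro y
    obtain ⟨y, rfl⟩ := U.mkQ_surjective y
    by_cases hy : y ∈ U
    · exact ⟨1, h1, 0, by simpa using ((Submodule.Quotient.mk_eq_zero U).2 hy).symm⟩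
    have hlt : U < U ⊔ Submodule.span R {y} := by
      refine lt_of_le_of_ne le_sup_left fun h => hy ?_
      rw [h]
      exact Submodule.mem_sup_right (Submodule.mem_span_singleton_self y)
    have hne : (U ⊔ Submodule.span R {y}) ⊓ LinearMap.range i ≠ ⊥ := fun h => hmax _ h hlt
    obtain ⟨z, ⟨hz, w, hw⟩, hz0⟩ := Submodule.exists_mem_ne_zero_of_ne_bot hne
    obtain ⟨v, hv, t, ht, rfl⟩ := Submodule.mem_sup.1 hz
    obtain ⟨a, rfl⟩ := Submodule.mem_span_singleton.1 ht
    refine ⟨a, fun ha => hz0 ?_, w, ?_⟩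
    · have hay : a • y = 0 := Module.mem_annihilator.1 (hle ha) y
      rw [hay, add_zero] at hw ⊢
      have : v ∈ U ⊓ LinearMap.range i := ⟨hv, w, hw⟩
      rwa [hU, Submodule.mem_bot] at this
    · rw [LinearMap.comp_apply, hw, map_add, map_smul, Submodule.mkQ_apply U v,
        (Submodule.Quotient.mk_eq_zero U).2 hv, zero_add]
  obtain ⟨a, ha, φ, hφ⟩ := exists_linearMap_of_forall_smul_mem_range hj hess
  refine ⟨LinearMap.range (φ ∘ₗ U.mkQ), fun h => ?_, hX.range_of_comp _ hi hM hM⟩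
  have h0 : φ (U.mkQ (i 1)) = 0 := by
    have : (φ ∘ₗ U.mkQ) (i 1) ∈ LinearMap.range (φ ∘ₗ U.mkQ) := ⟨_, rfl⟩
    rwa [h] at this
  have h2 := hφ (U.mkQ (i 1))
  rw [h0, map_zero] at h2
  exact ha ((smul_eq_zero_iff_mem_of_injective hj a).1 h2.symm)

theorem IsIKEClosed.submodule_quotient_of_isMaximal (hX : IsIKEClosed X) {p : PrimeSpectrum R}
    (hp : p ∈ Ass X) (hmax : p.asIdeal.IsMaximal) (J : Submodule R (R ⧸ p.asIdeal)) :
    X (of R J) := by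
  obtain ⟨I, hI, hXI⟩ := hX.exists_submodule_quotient hp
  have : IsSimpleModule R (R ⧸ p.asIdeal) := isSimpleModule_iff_isCoatom.2 hmax.out
  rcases eq_bot_or_eq_top J with rfl | rfl
  · exact hX.subsingleton hXI
  · exact prop_of_equiv (LinearEquiv.ofEq _ _ ((eq_bot_or_eq_top I).resolve_left hI)) hXI

/-- A module whose associated primes `p` are all such that `X` contains the submodules of `R ⧸ p`
is in `X`. -/
theorem IsIKEClosed.prop_of_associatedPrimes (hX : IsIKEClosed X) {Z : FGModuleCat.{u} R}
    (hZ : X Z) {M : Type u} [AddCommGroup M] [Module R M] [Module.Finite R M]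
    (h : ∀ p ∈ associatedPrimes R M, ∀ J : Submodule R (R ⧸ p), X (of R J)) : X (of R M) := by
  -- Noetherian induction: a maximal such N must be M, else the next layer enlarges it.
  obtain ⟨N, ⟨hN, hNM⟩, hmax⟩ := set_has_maximal_iff_noetherian.mpr
    (inferInstance : IsNoetherian R M) {N : Submodule R M | X (of R N) ∧
      associatedPrimes R (M ⧸ N) ⊆ associatedPrimes R M} ⟨⊥, hX.subsingleton (M := Z) hZ,
        (LinearEquiv.AssociatedPrimes.eq (Submodule.quotEquivOfEqBot ⊥ rfl)).subset⟩
  rcases subsingleton_or_nontrivial (M ⧸ N) with hs | hn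
  · exact hX.of_submodule N hN (hX.subsingleton (M := Z) hZ)
  exfalso
  obtain ⟨p, hp, K, J, hK, ⟨e⟩, hass⟩ := exists_submodule_of_associatedPrimes (R := R) (M ⧸ N)
  have hlt : N < K.comap N.mkQ := by
    refine lt_of_le_of_ne (fun x hx => ?_) fun heq => hK ?_
    · rw [Submodule.mem_comap, Submodule.mkQ_apply, (Submodule.Quotient.mk_eq_zero N).2 hx]
      exact K.zero_mem
    · rw [eq_bot_iff]
      intro y hy
      obtain ⟨y, rfl⟩ := N.mkQ_surjective y
      have : y ∈ K.comap N.mkQ := hy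
      rw [← heq] at this
      exact (Submodule.Quotient.mk_eq_zero N).2 this
  refine hmax (K.comap N.mkQ) ⟨?_, ?_⟩ hlt
  · let g : K.comap N.mkQ →ₗ[R] K := N.mkQ.restrict fun _ h => h
    refine hX.extension (f := Submodule.inclusion hlt.le) (g := g)
      (Submodule.inclusion_injective _) ?_ ?_ hN (prop_of_equiv e.symm (h p (hNM hp) J))
    · rintro ⟨y, hy⟩
      obtain ⟨y, rfl⟩ := N.mkQ_surjective y
      exact ⟨⟨y, hy⟩, rfl⟩
    · intro y
      refine ⟨fun hy => ⟨⟨y, ?_⟩, rfl⟩, ?_⟩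
      · exact (Submodule.Quotient.mk_eq_zero N).1 (congrArg Subtype.val hy)
      · rintro ⟨z, rfl⟩
        exact Subtype.ext ((Submodule.Quotient.mk_eq_zero N).2 z.2)
  · have e' : (M ⧸ K.comap N.mkQ) ≃ₗ[R] (M ⧸ N) ⧸ K :=
      (Submodule.quotEquivOfEq _ _ (by rw [LinearMap.ker_comp, Submodule.ker_mkQ])).trans
        ((K.mkQ ∘ₗ N.mkQ).quotKerEquivOfSurjective
          (K.mkQ_surjective.comp N.mkQ_surjective))
    rw [LinearEquiv.AssociatedPrimes.eq e']
    exact hass.trans hNM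

/-! ### Finite length modules and height one primes -/

section IsLocalRing

variable [IsLocalRing R]

open IsLocalRing

/-- Finitely generated modules killed by an ideal contained in no nonmaximal prime are in `X`. -/
theorem IsIKEClosed.prop_of_smul_eq_zero (hX : IsIKEClosed X) (hm : closedPoint R ∈ Ass X)
    {M : Type u} [AddCommGroup M] [Module R M] [Module.Finite R M]
    (h : ∀ p : Ideal R, p.IsPrime → p ≠ maximalIdeal R → ∃ a ∉ p, ∀ x : M, a • x = 0) :
    X (of R M) := by
  obtain ⟨Z, hZ, -⟩ := id hm
  refine hX.prop_of_associatedPrimes hZ fun p hp => ?_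
  obtain rfl : p = (closedPoint R).asIdeal := by
    by_contra hne
    obtain ⟨hpp, x, hx⟩ := isAssociatedPrime_iff_exists_smul_eq_zero_iff.1 hp
    obtain ⟨a, hap, ha⟩ := h p hpp hne
    exact hap ((hx a).1 (ha x))
  exact hX.submodule_quotient_of_isMaximal hm (maximalIdeal.isMaximal R)

theorem IsIKEClosed.submodule_quotient_of_forall_lt (hX : IsIKEClosed X)
    (hm : closedPoint R ∈ Ass X) {p : PrimeSpectrum R} (hp : p ∈ Ass X)
    (hlt : ∀ q : Ideal R, q.IsPrime → p.asIdeal < q → q = maximalIdeal R)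
    (J : Submodule R (R ⧸ p.asIdeal)) : X (of R J) := by
  -- Only m contains both p and a lift of a nonzero element of I.
  have key : ∀ I : Submodule R (R ⧸ p.asIdeal), I ≠ ⊥ → X (of R ((R ⧸ p.asIdeal) ⧸ I)) := by
    intro I hI
    obtain ⟨z, hz, hz0⟩ := Submodule.exists_mem_ne_zero_of_ne_bot hI
    obtain ⟨r, rfl⟩ := Ideal.Quotient.mk_surjective z
    have hrp : r ∉ p.asIdeal := fun h => hz0 (Ideal.Quotient.eq_zero_iff_mem.2 h)
    refine hX.prop_of_smul_eq_zero hm fun q hq hqm => ?_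
    by_cases hle : p.asIdeal ≤ q
    · refine ⟨r, fun hrq => hqm (hlt q hq (lt_of_le_of_ne hle fun h => hrp (h ▸ hrq))), ?_⟩
      intro x
      obtain ⟨x, rfl⟩ := I.mkQ_surjective x
      obtain ⟨s, rfl⟩ := Ideal.Quotient.mk_surjective x
      refine (Submodule.Quotient.mk_eq_zero I).2 ?_
      have := I.smul_mem s hz
      rwa [show s • Ideal.Quotient.mk p.asIdeal r = r • Ideal.Quotient.mk p.asIdeal s by
        simp only [Algebra.smul_def, Ideal.Quotient.algebraMap_eq, mul_comm]] at this
    · obtain ⟨b, hb, hbq⟩ := SetLike.not_le_iff_exists.1 hle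
      refine ⟨b, hbq, fun x => ?_⟩
      obtain ⟨x, rfl⟩ := I.mkQ_surjective x
      obtain ⟨s, rfl⟩ := Ideal.Quotient.mk_surjective x
      rw [← map_smul]
      have : b • Ideal.Quotient.mk p.asIdeal s = 0 :=
        Ideal.Quotient.eq_zero_iff_mem.2 (p.asIdeal.mul_mem_right s hb)
      rw [this, map_zero]
  obtain ⟨I, hI, hXI⟩ := hX.exists_submodule_quotient hp
  by_cases hJ : J = ⊥
  · subst hJ
    exact hX.subsingleton hXI
  · exact hX.submodule J (hX.of_submodule I hXI (key I hI)) (key J hJ)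

end IsLocalRing

end FGModuleCat

/-! ### Local principality from normality -/

/-- Ideals of a noetherian normal domain are principal in a neighbourhood of finitely many primes
of height at most one. -/
theorem exists_forall_mul_mem_span_singleton {R : Type*} [CommRing R] [IsDomain R]
    [IsNoetherianRing R] [IsIntegrallyClosed R] {S : Set (Ideal R)} (hfin : S.Finite)
    (hS : ∀ p ∈ S, p.IsPrime) (hlt : ∀ p ∈ S, ∀ q : Ideal R, q.IsPrime → q < p → q = ⊥)
    (I : Ideal R) :
    ∃ u ∈ I, ∃ s, s ≠ 0 ∧ (∀ p ∈ S, s ∉ p) ∧ ∀ x ∈ I, s * x ∈ Ideal.span {u} := by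
  let T : Submonoid R :=
    { carrier := {s | s ≠ 0 ∧ ∀ p ∈ S, s ∉ p}
      mul_mem' := fun {a b} ha hb => ⟨mul_ne_zero ha.1 hb.1, fun p hp h =>
        ((hS p hp).mem_or_mem h).elim (ha.2 p hp) (hb.2 p hp)⟩
      one_mem' := ⟨one_ne_zero, fun p hp h =>
        (hS p hp).ne_top ((Ideal.eq_top_iff_one p).2 h)⟩ }
  have hT : T ≤ nonZeroDivisors R := fun s hs => mem_nonZeroDivisors_of_ne_zero hs.1
  let A := Localization T
  have : IsDomain A := IsLocalization.isDomain_localization hT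
  have : IsNoetherianRing A := IsLocalization.isNoetherianRing T A inferInstance
  have : IsIntegrallyClosed A := isIntegrallyClosed_of_isLocalization A T hT
  have hmem : ∀ P : Ideal A, P.IsPrime → P ≠ ⊥ → P.under R ∈ S := by
    intro P hP hP0
    have hP' : (P.under R).IsPrime := Ideal.comap_isPrime _ _
    have hne : P.under R ≠ ⊥ := fun h => hP0 (by
      rw [← IsLocalization.map_under T A P, h, Ideal.map_bot])
    -- Elements outside 0 and all of S become units in A, so prime avoidance applies.
    have hsub : (P.under R : Set R) ⊆ ⋃ p ∈ insert ⊥ S, (p : Ideal R) := by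
      intro x hx
      by_contra hx'
      have hx'' : ∀ p ∈ insert ⊥ S, x ∉ p := by simpa using hx'
      have hxT : x ∈ T := ⟨fun h => hx'' ⊥ (Set.mem_insert _ _) h,
        fun p hp => hx'' p (Set.mem_insert_of_mem _ hp)⟩
      exact hP.ne_top (Ideal.eq_top_of_isUnit_mem P hx (IsLocalization.map_units A ⟨x, hxT⟩))
    obtain ⟨p, hp, hle⟩ := (Ideal.subset_union_prime_finite (hfin.insert ⊥) (f := id) ⊥ ⊥
      (by
        rintro p (rfl | hp) h -
        · exact absurd rfl h
        · exact hS p hp)).1 hsub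
    rcases hp with rfl | hp
    · exact absurd (eq_bot_iff.2 hle) hne
    · rcases eq_or_lt_of_le hle with h | h
      · exact h ▸ hp
      · exact absurd (hlt p hp _ hP' h) hne
  have hcomap : Function.Injective fun P : Ideal A => P.under R :=
    fun P Q h => by
      rw [← IsLocalization.map_under T A P, ← IsLocalization.map_under T A Q]
      exact congrArg _ h
  have : Ring.DimensionLEOne A := ⟨fun {P} hP0 hP => by
    obtain ⟨Q, hQ, hle⟩ := Ideal.exists_le_maximal P hP.ne_top
    have hQ0 : Q ≠ ⊥ := fun h => hP0 (eq_bot_iff.2 (h ▸ hle))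
    suffices P = Q from this ▸ hQ
    refine hcomap (eq_of_le_of_not_lt (Ideal.comap_mono hle) fun h => ?_)
    have h0 : P.under R = ⊥ := hlt _ (hmem Q hQ.isPrime hQ0) _ (Ideal.comap_isPrime _ _) h
    exact hP0 (by rw [← IsLocalization.map_under T A P, h0, Ideal.map_bot])⟩
  -- A Dedekind domain with finitely many primes is principal.
  have : IsDedekindDomain A := { }
  have hpid : IsPrincipalIdealRing A := by
    refine IsPrincipalIdealRing.of_finite_primes (Set.Finite.of_finite_image
      ((hfin.insert ⊥).subset ?_) hcomap.injOn)
    rintro _ ⟨P, hP, rfl⟩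
    by_cases h : P = ⊥
    · left
      subst h
      exact Ideal.comap_bot_of_injective _ (IsLocalization.injective A hT)
    · exact Or.inr (hmem P hP h)
  obtain ⟨v, hv⟩ := (hpid.principal (I.map (algebraMap R A))).principal
  have hvI : v ∈ I.map (algebraMap R A) := by
    rw [hv]
    exact Submodule.mem_span_singleton_self v
  obtain ⟨⟨⟨u, hu⟩, t⟩, hut⟩ := (IsLocalization.mem_map_algebraMap_iff T A).1 hvI
  have hloc : ∀ x ∈ I, ∃ s ∈ T, s * x ∈ Ideal.span {u} := by
    intro x hx
    have hx' : algebraMap R A x ∈ I.map (algebraMap R A) := Ideal.mem_map_of_mem _ hx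
    rw [hv] at hx'
    obtain ⟨c, hc⟩ := Submodule.mem_span_singleton.1 hx'
    obtain ⟨c, w, rfl⟩ := IsLocalization.exists_mk'_eq T c
    have h1 : algebraMap R A (t * w * x) = algebraMap R A (c * u) := by
      have h2 : algebraMap R A w * IsLocalization.mk' A c w = algebraMap R A c :=
        IsLocalization.mk'_spec' A c w
      simp only [map_mul]
      rw [← hc, ← hut, ← h2, smul_eq_mul]
      ring
    refine ⟨t * w, T.mul_mem t.2 w.2, Ideal.mem_span_singleton'.2 ⟨c, ?_⟩⟩
    exact (IsLocalization.injective A hT h1).symm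
  choose! a haT ha using hloc
  obtain ⟨G, rfl⟩ := IsNoetherian.noetherian I
  have hG : ∀ x ∈ G, x ∈ Submodule.span R (G : Set R) := fun x hx => Submodule.subset_span hx
  have hprod : ∏ x ∈ G, a x ∈ T := T.prod_mem fun x hx => haT x (hG x hx)
  refine ⟨u, hu, ∏ x ∈ G, a x, hprod.1, hprod.2, fun x hx => ?_⟩
  have hle : Submodule.span R (G : Set R) ≤
      Submodule.comap (LinearMap.mulLeft R (∏ x ∈ G, a x)) (Ideal.span {u}) := by
    refine Submodule.span_le.2 fun x hx => ?_
    obtain ⟨c, hc⟩ := Finset.dvd_prod_of_mem a hx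
    change (∏ x ∈ G, a x) * x ∈ Ideal.span {u}
    rw [hc, mul_right_comm]
    exact Ideal.mul_mem_right _ _ (ha x (hG x hx))
  exact hle hx

/-! ### The zero prime: ideals in X -/

namespace FGModuleCat

open CategoryTheory

open IsLocalRing

variable {R : Type u} [CommRing R] [IsNoetherianRing R] {X : ObjectProperty (FGModuleCat.{u} R)}
  [X.IsClosedUnderIsomorphisms]

/-- If `D ⊓ E` and `D ⊔ E` are in `X`, then so is `D`, as `D × E` is an extension of the two. -/
theorem IsIKEClosed.of_inf_of_sup (hX : IsIKEClosed X) {M : Type u} [AddCommGroup M] [Module R M]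
    [Module.Finite R M] {D E : Submodule R M} (hinf : X (of R ↥(D ⊓ E)))
    (hsup : X (of R ↥(D ⊔ E))) : X (of R D) := by
  let f : ↥(D ⊓ E) →ₗ[R] D × E :=
    (Submodule.inclusion inf_le_left).prod (-Submodule.inclusion inf_le_right)
  let g : D × E →ₗ[R] ↥(D ⊔ E) :=
    (Submodule.inclusion le_sup_left).coprod (Submodule.inclusion le_sup_right)
  have hDE : X (of R (D × E)) := by
    refine hX.extension (f := f) (g := g) (fun x y h => ?_) ?_ ?_ hinf hsup
    · exact Submodule.inclusion_injective _ (congrArg Prod.fst h)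
    · rintro ⟨x, hx⟩
      obtain ⟨d, hd, e, he, rfl⟩ := Submodule.mem_sup.1 hx
      exact ⟨(⟨d, hd⟩, ⟨e, he⟩), rfl⟩
    · rintro ⟨⟨d, hd⟩, ⟨e, he⟩⟩
      refine ⟨fun h => ?_, ?_⟩
      · have h' : d + e = 0 := congrArg Subtype.val h
        have hde : e = -d := (neg_eq_of_add_eq_zero_right h').symm
        refine ⟨⟨d, hd, ?_⟩, Prod.ext rfl (Subtype.ext hde.symm)⟩
        rw [eq_neg_of_add_eq_zero_left h']
        exact neg_mem he
      · rintro ⟨y, hy⟩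
        rw [← hy]
        exact Subtype.ext (add_neg_cancel (y : M))
  -- D is the image of the idempotent (d, e) ↦ (d, 0).
  refine prop_of_equiv ((LinearEquiv.ofEq _ _ ?_).trans
    (LinearEquiv.ofInjective (LinearMap.inl R D E) LinearMap.inl_injective).symm)
    (hX.range (LinearMap.inl R D E ∘ₗ LinearMap.fst R D E) hDE hDE)
  rw [LinearMap.range_comp, LinearMap.range_eq_top.2 LinearMap.fst_surjective, Submodule.map_top]

variable [IsDomain R] [IsLocalRing R] [IsIntegrallyClosed R]

/-- In the normal case, any nonzero ideal in `X` forces all ideals to be in `X`. -/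
theorem IsIKEClosed.ideal_of_ideal (hX : IsIKEClosed X) (hm : closedPoint R ∈ Ass X)
    (hdim : ∀ p q : Ideal R, p.IsPrime → q.IsPrime → p < q → q ≠ maximalIdeal R → p = ⊥)
    {I : Ideal R} (hI : I ≠ ⊥) (hXI : X (of R I)) (I' : Ideal R) : X (of R I') := by
  by_cases hI' : I' = ⊥
  · subst hI'
    exact hX.subsingleton hXI
  obtain ⟨c, hcI, hc0⟩ := Submodule.exists_mem_ne_zero_of_ne_bot hI
  let D : Ideal R := Submodule.map (LinearMap.mulLeft R c) I'
  have hinj : ∀ b : R, b ≠ 0 → Function.Injective (LinearMap.mulLeft R b) := fun b hb x y h =>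
    mul_left_cancel₀ hb h
  suffices X (of R D) from
    prop_of_equiv (Submodule.equivMapOfInjective _ (hinj c hc0) I').symm this
  have hDI : D ≤ I := by
    rintro _ ⟨x, -, rfl⟩
    exact I.mul_mem_right x hcI
  have hD : D ≠ ⊥ := by
    obtain ⟨x, hx, hx0⟩ := Submodule.exists_mem_ne_zero_of_ne_bot hI'
    exact (Submodule.ne_bot_iff D).2 ⟨c * x, ⟨x, hx, rfl⟩, mul_ne_zero hc0 hx0⟩
  -- C = (D : I) cuts out the primes where D and I differ.
  let C : Ideal R :=
    { carrier := {a | ∀ x ∈ I, a * x ∈ D}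
      add_mem' := fun {a b} ha hb x hx => by
        rw [add_mul]
        exact add_mem (ha x hx) (hb x hx)
      zero_mem' := fun x _ => by
        rw [zero_mul]
        exact D.zero_mem
      smul_mem' := fun r a ha x hx => by
        rw [smul_eq_mul, mul_assoc]
        exact D.mul_mem_left r (ha x hx) }
  have hDC : D ≤ C := fun d hd x _ => D.mul_mem_right x hd
  have hC : C ≠ ⊥ := fun h => hD (eq_bot_iff.2 (h ▸ hDC))
  let S : Set (Ideal R) := C.minimalPrimes \ {maximalIdeal R}
  have hSfin : S.Finite := (Ideal.finite_minimalPrimes_of_isNoetherianRing R C).sdiff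
  have hS : ∀ p ∈ S, p.IsPrime := fun p hp => hp.1.1.1
  have hlt : ∀ p ∈ S, ∀ q : Ideal R, q.IsPrime → q < p → q = ⊥ := fun p hp q hq h =>
    hdim q p hq (hS p hp) h hp.2
  obtain ⟨u, huI, s, hs0, hsS, hsI⟩ := exists_forall_mul_mem_span_singleton hSfin hS hlt I
  obtain ⟨d, hdD, t, ht0, htS, htD⟩ := exists_forall_mul_mem_span_singleton hSfin hS hlt D
  -- b = sd/u, where u and d generate I and D near S; so bI is D there.
  obtain ⟨b, hb⟩ := Ideal.mem_span_singleton'.1 (hsI d (hDI hdD))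
  have hu0 : u ≠ 0 := by
    rintro rfl
    obtain ⟨x, hx, hx0⟩ := Submodule.exists_mem_ne_zero_of_ne_bot hI
    have := hsI x hx
    rw [Ideal.span_singleton_eq_bot.2 rfl, Ideal.mem_bot] at this
    exact mul_ne_zero hs0 hx0 this
  have hd0 : d ≠ 0 := by
    rintro rfl
    obtain ⟨x, hx, hx0⟩ := Submodule.exists_mem_ne_zero_of_ne_bot hD
    have := htD x hx
    rw [Ideal.span_singleton_eq_bot.2 rfl, Ideal.mem_bot] at this
    exact mul_ne_zero ht0 hx0 this
  have hb0 : b ≠ 0 := by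
    rintro rfl
    rw [zero_mul] at hb
    exact mul_ne_zero hs0 hd0 hb.symm
  let B : Ideal R := Submodule.map (LinearMap.mulLeft R b) I
  have hXB : X (of R B) := prop_of_equiv (Submodule.equivMapOfInjective _ (hinj b hb0) I) hXI
  have hBI : B ≤ I := by
    rintro _ ⟨x, hx, rfl⟩
    exact I.mul_mem_left b hx
  have hBD : B ≤ D := by
    rintro _ ⟨x, hx, rfl⟩
    obtain ⟨r, hr⟩ := Ideal.mem_span_singleton'.1 (hsI x hx)
    have : s * (b * x) = s * (r * d) := by linear_combination b * (-hr) + r * hb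
    rw [LinearMap.mulLeft_apply, mul_left_cancel₀ hs0 this]
    exact D.mul_mem_left r hdD
  have hstD : ∀ x ∈ D, s * t * x ∈ B := by
    intro x hx
    obtain ⟨r, hr⟩ := Ideal.mem_span_singleton'.1 (htD x hx)
    refine ⟨r * u, I.mul_mem_left r huI, ?_⟩
    rw [LinearMap.mulLeft_apply]
    linear_combination r * hb + s * hr
  have hstC : ∀ a ∈ C, ∃ r, s * t * a = r * b := by
    intro a ha
    obtain ⟨r, hr⟩ := Ideal.mem_span_singleton'.1 (htD (a * u) (ha u huI))
    refine ⟨r, mul_right_cancel₀ hu0 ?_⟩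
    linear_combination -s * hr - r * hb
  -- E is B where C is the unit ideal and, by `hstC`, I near S.
  let E : Ideal R :=
    { carrier := {x | x ∈ I ∧ ∀ a ∈ C, a * x ∈ B}
      add_mem' := fun {x y} hx hy => ⟨add_mem hx.1 hy.1, fun a ha => by
        rw [mul_add]
        exact add_mem (hx.2 a ha) (hy.2 a ha)⟩
      zero_mem' := ⟨I.zero_mem, fun a _ => by
        rw [mul_zero]
        exact B.zero_mem⟩
      smul_mem' := fun r x hx => ⟨I.mul_mem_left r hx.1, fun a ha => by
        rw [smul_eq_mul, mul_left_comm]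
        exact B.mul_mem_left r (hx.2 a ha)⟩ }
  have hpt : ∀ p : Ideal R, p.IsPrime → p ≠ maximalIdeal R → s * t ∉ p ∨ ∃ a ∈ C, a ∉ p := by
    intro p hp hpm
    by_cases hCp : C ≤ p
    · left
      obtain ⟨q, hq, hqp⟩ := Ideal.exists_minimalPrimes_le hCp
      have hqm : q ≠ maximalIdeal R := fun h =>
        hpm (((maximalIdeal.isMaximal R).eq_of_le hp.ne_top (h ▸ hqp)).symm)
      have hqS : q ∈ S := ⟨hq, hqm⟩
      have hqp' : q = p := by
        -- Otherwise q would be zero by the dimension bound, but C ≠ 0.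
        by_contra hne
        have := hdim q p hq.1.1 hp (lt_of_le_of_ne hqp hne) hpm
        exact hC (eq_bot_iff.2 (this ▸ hq.1.2))
      subst hqp'
      exact fun h => (hp.mem_or_mem h).elim (hsS q hqS) (htS q hqS)
    · exact Or.inr (SetLike.not_le_iff_exists.1 hCp)
  have hEI : E ≤ I := fun x hx => hx.1
  have hBE : B ≤ E := fun x hx => ⟨hBI hx, fun a _ => B.mul_mem_left a hx⟩
  have hinf : X (of R ↥(D ⊓ E)) := by
    have hle : B ≤ D ⊓ E := le_inf hBD hBE
    refine hX.of_submodule (B.submoduleOf (D ⊓ E))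
      (prop_of_equiv (Submodule.submoduleOfEquivOfLe hle).symm hXB)
      (hX.prop_of_smul_eq_zero hm fun p hp hpm => ?_)
    rcases hpt p hp hpm with h | ⟨a, haC, hap⟩
    · refine ⟨s * t, h, fun x => ?_⟩
      obtain ⟨x, rfl⟩ := Submodule.mkQ_surjective _ x
      exact (Submodule.Quotient.mk_eq_zero _).2 (hstD x x.2.1)
    · refine ⟨a, hap, fun x => ?_⟩
      obtain ⟨x, rfl⟩ := Submodule.mkQ_surjective _ x
      exact (Submodule.Quotient.mk_eq_zero _).2 (x.2.2.2 a haC)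
  have hsup : X (of R ↥(D ⊔ E)) := by
    have hle : D ⊔ E ≤ I := sup_le hDI hEI
    refine prop_of_equiv (Submodule.submoduleOfEquivOfLe hle)
      (hX.submodule ((D ⊔ E).submoduleOf I) hXI
        (hX.prop_of_smul_eq_zero hm fun p hp hpm => ?_))
    rcases hpt p hp hpm with h | ⟨a, haC, hap⟩
    · refine ⟨s * t, h, fun x => ?_⟩
      obtain ⟨x, rfl⟩ := Submodule.mkQ_surjective _ x
      refine (Submodule.Quotient.mk_eq_zero _).2 (Submodule.mem_sup_right (S := D)
        (⟨I.mul_mem_left _ x.2, fun a ha => ?_⟩ : s * t * (x : R) ∈ E))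
      obtain ⟨r, hr⟩ := hstC a ha
      refine ⟨r * x, I.mul_mem_left r x.2, ?_⟩
      rw [LinearMap.mulLeft_apply]
      linear_combination -(x : R) * hr
    · refine ⟨a, hap, fun x => ?_⟩
      obtain ⟨x, rfl⟩ := Submodule.mkQ_surjective _ x
      exact (Submodule.Quotient.mk_eq_zero _).2
        (Submodule.mem_sup_left (T := E) (haC x x.2) : a * (x : R) ∈ D ⊔ E)
  exact hX.of_inf_of_sup hinf hsup

theorem IsIKEClosed.submodule_quotient (hX : IsIKEClosed X) (hm : closedPoint R ∈ Ass X)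
    (hdim : ∀ p q : Ideal R, p.IsPrime → q.IsPrime → p < q → q ≠ maximalIdeal R → p = ⊥)
    {p : PrimeSpectrum R} (hp : p ∈ Ass X) (J : Submodule R (R ⧸ p.asIdeal)) : X (of R J) := by
  by_cases hp0 : p.asIdeal = ⊥
  · obtain ⟨I, hI, hXI⟩ := hX.exists_submodule_quotient hp
    let e : (R ⧸ p.asIdeal) ≃ₗ[R] R := Submodule.quotEquivOfEqBot _ hp0
    have hXI' : X (of R ↥(I.map e.toLinearMap)) :=
      prop_of_equiv (Submodule.equivMapOfInjective _ e.injective I) hXI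
    have hI0 : I.map e.toLinearMap ≠ ⊥ := fun h => hI (Submodule.map_eq_bot_iff.1 h)
    exact prop_of_equiv (Submodule.equivMapOfInjective e.toLinearMap e.injective J).symm
      (hX.ideal_of_ideal hm hdim hI0 hXI' (J.map e.toLinearMap))
  · refine hX.submodule_quotient_of_forall_lt hm hp (fun q hq hlt => ?_) J
    by_contra hne
    exact hp0 (hdim _ q p.2 hq hlt hne)

end FGModuleCat

/-! ### Dimension two and the conclusion -/

theorem Ideal.eq_bot_of_lt_of_ringKrullDim_le_two {R : Type*} [CommRing R] [IsDomain R]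
    [IsLocalRing R] (hdim : ringKrullDim R ≤ 2) (p q : Ideal R) (hp : p.IsPrime) (hq : q.IsPrime)
    (hpq : p < q) (hqm : q ≠ IsLocalRing.maximalIdeal R) : p = ⊥ := by
  by_contra hp0
  have h1 : (⟨⊥, Ideal.isPrime_bot⟩ : PrimeSpectrum R) < ⟨p, hp⟩ :=
    bot_lt_iff_ne_bot.2 (mt PrimeSpectrum.ext_iff.1 hp0)
  have h2 : (⟨p, hp⟩ : PrimeSpectrum R) < ⟨q, hq⟩ := hpq
  have h3 : (⟨q, hq⟩ : PrimeSpectrum R) < IsLocalRing.closedPoint R :=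
    lt_of_le_of_ne (IsLocalRing.le_maximalIdeal hq.ne_top)
      (mt PrimeSpectrum.ext_iff.1 hqm)
  let l : LTSeries (PrimeSpectrum R) :=
    { length := 3
      toFun := ![⟨⊥, Ideal.isPrime_bot⟩, ⟨p, hp⟩, ⟨q, hq⟩, IsLocalRing.closedPoint R]
      step := fun i => by
        fin_cases i
        exacts [h1, h2, h3] }
  have hl : (3 : WithBot ℕ∞) ≤ ringKrullDim R := Order.LTSeries.length_le_krullDim l
  exact absurd (hl.trans hdim) (by decide)

open FGModuleCat in
theorem mainTheorem10 (R : Type u) [CommRing R] [IsDomain R] [IsLocalRing R]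
    [IsIntegrallyClosed R] [CharZero R] (hR : IsExcellentRing R) (hdim : ringKrullDim R = 2)
    (X : CategoryTheory.ObjectProperty (FGModuleCat.{u} R)) [X.IsClosedUnderIsomorphisms]
    (hX : FGModuleCat.IsIKEClosed X) (hm : IsLocalRing.closedPoint R ∈ FGModuleCat.Ass X) :
    X = FGModuleCat.AssInv (FGModuleCat.Ass X) ∧ FGModuleCat.IsTorsionfreeSubcategory X := by
  have := hR.isNoetherianRing
  obtain ⟨Z, hZ, -⟩ := id hm
  have heq : X = AssInv (Ass X) := by
    ext M
    refine ⟨fun hM p hp => ⟨M, hM, hp⟩, fun hM => ?_⟩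
    exact hX.prop_of_associatedPrimes (M := M) hZ fun p hp => hX.submodule_quotient hm
      (Ideal.eq_bot_of_lt_of_ringKrullDim_le_two hdim.le) (hM ⟨p, hp.1⟩ hp)
  refine ⟨heq, ⟨fun {M N} f _ hN => ?_⟩, hX.extensions⟩
  rw [heq] at hN ⊢
  have hf : Function.Injective f.hom.hom :=
    (ModuleCat.mono_iff_injective ((CategoryTheory.forget₂ (FGModuleCat R) (ModuleCat R)).map f)).1
      inferInstance
  exact fun p hp => hN p (associatedPrimes.subset_of_injective hf hp)
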